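/- Let $n\ge 1$, let $T\subset\mathbb{R}^2$ be the triangle with vertices $(0,0)$, $(0,1)$, $(1,0)$, and let $X_1,\dots,X_n$ be independent random points, each uniformly distributed in $T$. Let $T_n$ be the convex hull of $X_1,\dots,X_n,(0,1),(1,0)$, and let $f_0(T_n)$ be the number of vertices of $T_n$, where the two fixed vertices $(0,1)$ and $(1,0)$ are not counted. For $k=1,\dots,n$ put $p_k^{(n)}:=\mathbb{P}(f_0(T_n)=k)$. Then, for $k=1,\dots,n$, $$p_k^{(n)}=2^k\sum_{i_1+\dots+i_k=n}\frac{1}{i_1(i_1+i_2)\cdots(i_1+\dots+i_k)}\cdot\frac{i_1\cdots i_k}{(i_1+1)(i_1+i_2+1)\cdots(i_1+\dots+i_k+1)},$$ where the sum runs over all integers $i_1,\dots,i_k\ge 1$ with $i_1+\dots+i_k=n$, and the sequence $(p_k^{(n)})_{k=1}^n$ is a Pólya frequency sequence. That is, with $a_k:=p_k^{(n)}$ for $1\le k\le n$ and $a_k:=0$ for all other integers $k$, all $a_k$ are non-negative and the infinite Toeplitz matrix $(a_{i-j})_{i,j\ge 0}$ is totally positive, meaning that all its minors (determinants of finite square submatrices)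 are non-negative. -/

import Mathlib

open MeasureTheory ProbabilityTheory

noncomputable section

namespace RandomConvexChain

/-- The closed triangle in the plane with vertices `(0,0)`, `(0,1)` and `(1,0)`. -/
def triangle : Set (ℝ × ℝ) := convexHull ℝ {(0, 0), (0, 1), (1, 0)}

/-- The convex chain generated by finitely many points: their convex hull together with the two
corners `(0,1)` and `(1,0)` of the triangle. -/
def chain {n : ℕ} (x : Fin n → ℝ × ℝ) : Set (ℝ × ℝ) :=
  convexHull ℝ (Set.range x ∪ {(0, 1), (1, 0)})

/-- The number of vertices (extreme points) of the convex chain, where the two fixed corners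
`(0,1)` and `(1,0)`, which every chain has, are not counted. -/
def vertexCount {n : ℕ} (x : Fin n → ℝ × ℝ) : ℕ :=
  ((chain x).extremePoints ℝ \ {(0, 1), (1, 0)}).ncard

/-- The probability that the convex chain generated by the random points `X 0, …, X (n-1)` has
exactly `k` vertices. -/
def vertexProb {Ω : Type*} [MeasurableSpace Ω] (P : Measure Ω) {n : ℕ} (X : Fin n → Ω → ℝ × ℝ)
    (k : ℕ) : ℝ :=
  P.real {ω | vertexCount (fun i => X i ω) = k}

/-- The tuples `(i_1, …, i_k)` of integers `≥ 1` with `i_1 + ⋯ + i_k = n`. -/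
def compositions (n k : ℕ) : Finset (Fin k → ℕ) :=
  {i ∈ Finset.univ.piAntidiag n | ∀ j, 1 ≤ i j}

/-- The explicit expression
`2^k ∑ 1 / (i_1 (i_1+i_2) ⋯ (i_1+⋯+i_k)) * (i_1 ⋯ i_k) / ((i_1+1) (i_1+i_2+1) ⋯ (i_1+⋯+i_k+1))`,
the sum running over all integers `i_1, …, i_k ≥ 1` with `i_1 + ⋯ + i_k = n`. -/
def explicitProb (n k : ℕ) : ℝ :=
  2 ^ k * ∑ i ∈ compositions n k,
    (1 / ∏ j, ∑ l ∈ Finset.Iic j, (i l : ℝ)) *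
      ((∏ j, (i j : ℝ)) / ∏ j, ((∑ l ∈ Finset.Iic j, (i l : ℝ)) + 1))

/-- An infinite matrix is totally positive if all its (finite) minors are non-negative. -/
def IsTotallyPositive (A : Matrix ℕ ℕ ℝ) : Prop :=
  ∀ (m : ℕ) (r c : Fin m → ℕ), StrictMono r → StrictMono c → 0 ≤ (A.submatrix r c).det

/-- The infinite Toeplitz matrix `(a_{i-j})_{i,j ≥ 0}`, where `a_k := 0` for `k < 0`. -/
def toeplitz (a : ℕ → ℝ) : Matrix ℕ ℕ ℝ :=
  Matrix.of fun i j => if j ≤ i then a (i - j) else 0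

/-- Pólya frequency sequences: sequences of non-negative reals with totally positive Toeplitz
matrix. -/
def IsPolyaFrequency (a : ℕ → ℝ) : Prop :=
  (∀ k, 0 ≤ a k) ∧ IsTotallyPositive (toeplitz a)

/-- The finite sequence `a_1, …, a_n`, extended by zero to all other indices. -/
def extendByZero (n : ℕ) (a : ℕ → ℝ) : ℕ → ℝ :=
  fun k => if 1 ≤ k ∧ k ≤ n then a k else 0

end RandomConvexChain

end

/-!
Let `e(n, k)` denote `explicitProb n k`. Splitting off the last part of a composition gives
`e(n, k+1) = ∑_{m<n} 2 (n-m) / (n (n+1)) e(m, k)` (`explicitProb_succ`), and both claims come from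
this recursion.

**The probabilities.** Let `v = (x, y)` be the random point first met by a ray turning about `(1,0)`
from the bottom side of the triangle. Then `v` is a vertex of the chain, the points in the triangle
with vertices `v`, `(0,1)`, `(1,0)` are not, and the remaining points, which lie in the triangle cut
off by the lines through `v` and `(0,1)` and through `v` and `(1,0)`, are vertices exactly if they
are vertices of the chain that joins `(0,1)` to `v` (`freeVertices_insert_union`). An affine map
carries this smaller triangle to the standard one, so the volume of the configurations with `k+1`
vertices is a sum, over the index of `v` and the set of indices of the points beyond `v`, of a volume
for fewer points and `k` vertices, multiplied by
`∫ (x / (1-x))^b (1-x-y)^(n-1)` over the triangle, where `b` is the number of points beyond `v`. This is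
a Beta integral; with the powers of `2` that come from the area `1/2` of the triangle, the sum
reproduces the recursion.

No configuration has to be shown to be in general position: the induction only produces disjoint
events on which the count is `k` and whose probability is `e(n, k)`. Since `∑_k e(n, k) = 1`
(`sum_explicitProb`), these events exhaust the probability space up to a null set.

**The Pólya frequency property.** Let `G_n(z) = ∑_k e(n, k) z^k` and `F_n = n (n+1) G_n`. The
recursion says that `F_{m+1} - 2 F_m + F_{m-1} = 2 z G_m` and `F_0 = 0`. If `F_n(z) = 0`, then
multiplying by the conjugate of `F_m` and summing by parts yields
`-∑ |F_{m+1} - F_m|^2 = 2 z ∑ m (m+1) |G_m|^2`, so `z` is real and `z ≤ 0` (`root_vertexPoly`). Hence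
`G_n` is a non-negative multiple of a product of factors `X + r` with `r ≥ 0`, and multiplication by
such a factor preserves total positivity of the Toeplitz matrix of the coefficients.
-/

noncomputable section

namespace RandomConvexChain

/-! ### Total positivity of Toeplitz matrices -/

open Polynomial in
theorem toeplitz_X_add_C_mul (q : ℝ[X]) (r : ℝ) (i j : ℕ) :
    toeplitz ((X + C r) * q).coeff i j
      = toeplitz q.coeff i (j + 1) + r * toeplitz q.coeff i j := by
  simp only [toeplitz, Matrix.of_apply, add_mul, coeff_add, coeff_C_mul]
  rcases lt_trichotomy i j with h | rfl | h
  · simp [Nat.not_le.2 h, Nat.not_le.2 (h.trans (Nat.lt_succ_self j))]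
  · simp
  · obtain ⟨d, rfl⟩ := Nat.exists_eq_add_of_lt h
    have h1 : j + d + 1 - j = d + 1 := by omega
    have h2 : j + d + 1 - (j + 1) = d := by omega
    rw [if_pos (by omega), if_pos (by omega), if_pos (by omega), h1, h2, coeff_X_mul]

/-- Replacing each column by its successor plus a non-negative multiple of itself preserves total
positivity. By multilinearity a minor of `B` is a non-negative combination of minors of `A` whose
column indices are increased by `0` or `1` each; two of them may coincide, and then the minor
vanishes. -/
theorem IsTotallyPositive.of_column_combination {A B : Matrix ℕ ℕ ℝ} (hA : IsTotallyPositive A)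
    {r : ℝ} (hr : 0 ≤ r) (hB : ∀ i j, B i j = A i (j + 1) + r * A i j) :
    IsTotallyPositive B := by
  classical
  intro m ρ c hρ hc
  let col : ℕ → Fin m → ℝ := fun j i => A (ρ i) j
  have hdet : (B.submatrix ρ c).det = Matrix.detRowAlternating
      ((fun j => col (c j + 1)) + fun j => r • col (c j)) := by
    rw [← Matrix.det_transpose]
    congr 1
    ext j i
    simp [hB, col]
  rw [hdet]
  have := (Matrix.detRowAlternating (n := Fin m) (R := ℝ)).toMultilinearMap.map_add_univ
    (fun j => col (c j + 1)) (fun j => r • col (c j))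
  simp only [AlternatingMap.coe_multilinearMap] at this
  rw [this]
  refine Finset.sum_nonneg fun s _ => ?_
  have hs : s.piecewise (fun j => col (c j + 1)) (fun j => r • col (c j))
      = fun j => (if j ∈ s then 1 else r) • col (c j + if j ∈ s then 1 else 0) := by
    ext j i
    by_cases hj : j ∈ s <;> simp [Finset.piecewise, hj]
  rw [hs]
  have hsm := (Matrix.detRowAlternating (n := Fin m) (R := ℝ)).toMultilinearMap.map_smul_univ
    (fun j => if j ∈ s then 1 else r) (fun j => col (c j + if j ∈ s then 1 else 0))
  simp only [AlternatingMap.coe_multilinearMap] at hsm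
  rw [hsm, smul_eq_mul]
  refine mul_nonneg (Finset.prod_nonneg fun j _ => by split_ifs <;> simp [hr]) ?_
  set d : Fin m → ℕ := fun j => c j + if j ∈ s then 1 else 0 with hd
  have hmono : Monotone d := by
    intro a b hab
    rcases hab.eq_or_lt with rfl | hab
    · exact le_rfl
    · have := hc hab
      simp only [hd]
      split_ifs <;> omega
  by_cases hinj : Function.Injective d
  · have := hA m ρ d hρ (hmono.strictMono_of_injective hinj)
    rw [← Matrix.det_transpose] at this
    exact this
  · simp only [Function.Injective, not_forall] at hinj
    obtain ⟨a, b, hab, hne⟩ := hinj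
    refine ((Matrix.detRowAlternating (n := Fin m) (R := ℝ)).map_eq_zero_of_eq
      (fun j => col (d j)) (by simp only [hab]) hne).ge

open Polynomial in
theorem isTotallyPositive_toeplitz_C {a : ℝ} (ha : 0 ≤ a) :
    IsTotallyPositive (toeplitz (C a : ℝ[X]).coeff) := by
  have hT : ∀ i j, toeplitz (C a : ℝ[X]).coeff i j = if i = j then a else 0 := by
    intro i j
    simp only [toeplitz, Matrix.of_apply, coeff_C]
    split_ifs <;> first | rfl | omega
  intro m r c hr hc
  by_cases h : ∀ i, ∃ j, r i = c j
  · have hrc : r = c := by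
      have : Set.range r ⊆ Set.range c := by
        rintro _ ⟨i, rfl⟩
        obtain ⟨j, hj⟩ := h i
        exact ⟨j, hj.symm⟩
      refine (hr.range_inj hc).1 (Set.eq_of_subset_of_ncard_le this ?_ (Set.finite_range c))
      rw [Set.ncard_range_of_injective hr.injective, Set.ncard_range_of_injective hc.injective]
    subst hrc
    have : (toeplitz (C a : ℝ[X]).coeff).submatrix r r = Matrix.diagonal fun _ => a := by
      ext i j
      simp [hT, Matrix.diagonal_apply, hr.injective.eq_iff]
    rw [this, Matrix.det_diagonal]
    exact Finset.prod_nonneg fun _ _ => ha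
  · push Not at h
    obtain ⟨i, hi⟩ := h
    exact (Matrix.det_eq_zero_of_row_eq_zero i fun j => by simp [hT, hi j]).ge

open Polynomial in
/-- The coefficients of a real polynomial with non-negative leading coefficient, all of whose
complex roots are real and non-positive, have a totally positive Toeplitz matrix. -/
theorem isTotallyPositive_toeplitz_of_roots (p : ℝ[X]) (hlead : 0 ≤ p.leadingCoeff)
    (hroots : ∀ z : ℂ, aeval z p = 0 → ∃ r : ℝ, 0 ≤ r ∧ z = -(r : ℂ)) :
    IsTotallyPositive (toeplitz p.coeff) := by
  induction hd : p.natDegree generalizing p with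
  | zero =>
    rw [eq_C_of_natDegree_eq_zero hd] at hlead ⊢
    exact isTotallyPositive_toeplitz_C (by simpa using hlead)
  | succ d ih =>
    have hdeg : (p.map (algebraMap ℝ ℂ)).degree ≠ 0 := by
      rw [degree_map]
      exact (degree_pos_of_ne_zero_of_nonunit (by rintro rfl; simp at hd)
        (fun hu => by simp [natDegree_eq_zero_of_isUnit hu] at hd)).ne'
    obtain ⟨z, hz⟩ := IsAlgClosed.exists_root _ hdeg
    rw [IsRoot, eval_map_algebraMap] at hz
    obtain ⟨r, hr, rfl⟩ := hroots z hz
    have hz' : p.IsRoot (-r) := by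
      have h1 : ((-r : ℝ) : ℂ) = -(r : ℂ) := by push_cast; rfl
      rw [← h1, ← Complex.coe_algebraMap, aeval_algebraMap_apply] at hz
      simpa using hz
    obtain ⟨q, hpq⟩ := dvd_iff_isRoot.2 hz'
    rw [show (X - C (-r) : ℝ[X]) = X + C r by simp] at hpq
    subst hpq
    have hq : q ≠ 0 := by rintro rfl; simp at hd
    have hmonic : (X + C r : ℝ[X]).Monic := monic_X_add_C r
    refine (ih q (by rwa [leadingCoeff_monic_mul hmonic] at hlead) (fun z hz => hroots z ?_)
      ?_).of_column_combination hr (toeplitz_X_add_C_mul q r)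
    · simp [hz]
    · rw [hmonic.natDegree_mul' hq, natDegree_X_add_C] at hd
      omega

/-! ### The explicit expression and its generating polynomial -/

theorem mem_compositions {n k : ℕ} {i : Fin k → ℕ} :
    i ∈ compositions n k ↔ ∑ j, i j = n ∧ ∀ j, 1 ≤ i j := by
  simp [compositions, Finset.mem_piAntidiag]

/-- The summand of `explicitProb` that belongs to the tuple `i`. -/
def compositionWeight {k : ℕ} (i : Fin k → ℕ) : ℝ :=
  (1 / ∏ j, ∑ l ∈ Finset.Iic j, (i l : ℝ)) *
    ((∏ j, (i j : ℝ)) / ∏ j, ((∑ l ∈ Finset.Iic j, (i l : ℝ)) + 1))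

theorem compositionWeight_snoc {k : ℕ} (i : Fin k → ℕ) (a : ℕ) :
    compositionWeight (Fin.snoc i a : Fin (k + 1) → ℕ) = compositionWeight i *
      (a / ((∑ j, i j + a : ℕ) * ((∑ j, i j + a : ℕ) + 1))) := by
  have h1 : ∀ j : Fin k, ∑ l ∈ Finset.Iic j.castSucc, ((Fin.snoc i a : Fin (k + 1) → ℕ) l : ℝ)
      = ∑ l ∈ Finset.Iic j, (i l : ℝ) := by
    intro j
    rw [← Fin.map_castSuccEmb_Iic, Finset.sum_map]
    simp
  have h2 : ∑ l ∈ Finset.Iic (Fin.last k), ((Fin.snoc i a : Fin (k + 1) → ℕ) l : ℝ)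
      = (∑ j, i j + a : ℕ) := by
    rw [show Finset.Iic (Fin.last k) = Finset.univ from by ext; simp [Fin.le_last],
      Fin.sum_univ_castSucc]
    simp
  simp only [compositionWeight, Fin.prod_univ_castSucc, h1, h2, Fin.snoc_castSucc, Fin.snoc_last]
  simp only [div_eq_mul_inv, mul_inv]
  ring

theorem explicitProb_eq (n k : ℕ) :
    explicitProb n k = 2 ^ k * ∑ i ∈ compositions n k, compositionWeight i := rfl

theorem explicitProb_nonneg (n k : ℕ) : 0 ≤ explicitProb n k := by
  unfold explicitProb
  positivity

theorem explicitProb_zero_right (n : ℕ) : explicitProb n 0 = if n = 0 then 1 else 0 := by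
  rw [explicitProb_eq]
  split_ifs with h
  · have : compositions n 0 = {Fin.elim0} := by
      ext i
      simp [mem_compositions, h, Subsingleton.elim i Fin.elim0]
    simp [this, compositionWeight]
  · have : compositions n 0 = ∅ := by
      ext i
      simp [mem_compositions, Ne.symm h]
    simp [this]

theorem explicitProb_succ (n k : ℕ) :
    explicitProb n (k + 1) =
      ∑ m ∈ Finset.range n, 2 * ((n : ℝ) - m) / (n * (n + 1)) * explicitProb m k := by
  have key : ∑ i ∈ compositions n (k + 1), compositionWeight i =
      ∑ p ∈ (Finset.range n).sigma fun m => compositions m k,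
        compositionWeight p.2 * (((n : ℝ) - p.1) / (n * (n + 1))) := by
    refine Finset.sum_bij' (fun c _ => ⟨∑ j, Fin.init c j, Fin.init c⟩)
      (fun p _ => Fin.snoc p.2 (n - p.1)) ?_ ?_ ?_ ?_ ?_
    · intro c hc
      obtain ⟨hs, h1⟩ := mem_compositions.1 hc
      rw [Fin.sum_univ_castSucc] at hs
      have := h1 (Fin.last k)
      simp only [Finset.mem_sigma, Finset.mem_range, mem_compositions, Fin.init]
      exact ⟨by omega, trivial, fun j => h1 _⟩
    · rintro ⟨m, i⟩ hp
      simp only [Finset.mem_sigma, Finset.mem_range, mem_compositions] at hp ⊢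
      obtain ⟨hm, hs, h1⟩ := hp
      refine ⟨by simp [Fin.sum_univ_castSucc, hs]; omega, fun j => ?_⟩
      refine Fin.lastCases ?_ (fun j => ?_) j
      · simp; omega
      · simpa using h1 j
    · intro c hc
      obtain ⟨hs, h1⟩ := mem_compositions.1 hc
      rw [Fin.sum_univ_castSucc] at hs
      have : n - ∑ j, Fin.init c j = c (Fin.last k) := by simp only [Fin.init]; omega
      simp only [this, Fin.snoc_init_self]
    · rintro ⟨m, i⟩ hp
      simp only [Finset.mem_sigma, Finset.mem_range, mem_compositions] at hp
      simp [hp.2.1]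
    · intro c hc
      obtain ⟨hs, h1⟩ := mem_compositions.1 hc
      rw [Fin.sum_univ_castSucc] at hs
      conv_lhs => rw [← Fin.snoc_init_self c, compositionWeight_snoc]
      have h2 : ∑ j, Fin.init c j + c (Fin.last k) = n := hs
      have h3 : (c (Fin.last k) : ℝ) = n - (∑ j, Fin.init c j : ℕ) := by
        rw [← h2]; push_cast; ring
      rw [h2, h3]
  rw [explicitProb_eq, key, Finset.sum_sigma, Finset.mul_sum]
  refine Finset.sum_congr rfl fun m _ => ?_
  simp only [explicitProb_eq, ← Finset.sum_mul]
  ring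

theorem explicitProb_eq_zero {n k : ℕ} (h : n < k) : explicitProb n k = 0 := by
  have : compositions n k = ∅ := by
    ext i
    simp only [mem_compositions, Finset.notMem_empty, iff_false, not_and]
    intro hs h1
    have : ∑ _j : Fin k, 1 ≤ ∑ j, i j := Finset.sum_le_sum fun j _ => h1 j
    simp at this
    omega
  simp [explicitProb_eq, this]

open Polynomial in
/-- The generating polynomial of the numbers `explicitProb n k`, `k = 0, …, n`. -/
def vertexPoly (n : ℕ) : ℝ[X] := ∑ k ∈ Finset.range (n + 1), C (explicitProb n k) * X ^ k

open Polynomial in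
theorem coeff_vertexPoly (n k : ℕ) : (vertexPoly n).coeff k = explicitProb n k := by
  simp only [vertexPoly, finsetSum_coeff, coeff_C_mul, coeff_X_pow]
  simp only [mul_ite, mul_one, mul_zero, Finset.sum_ite_eq, Finset.mem_range]
  split_ifs with h
  · rfl
  · exact (explicitProb_eq_zero (by omega)).symm

open Polynomial in
theorem vertexPoly_zero : vertexPoly 0 = 1 := by
  simp [vertexPoly, explicitProb_zero_right]

open Polynomial in
theorem vertexPoly_recursion (n : ℕ) :
    C ((n : ℝ) * (n + 1)) * vertexPoly n =
      2 * X * ∑ m ∈ Finset.range n, C ((n : ℝ) - m) * vertexPoly m := by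
  rcases Nat.eq_zero_or_pos n with rfl | hn
  · simp
  have hn' : (n : ℝ) ≠ 0 := by positivity
  ext k
  rw [mul_assoc 2 X, show (2 : ℝ[X]) = C 2 from rfl, coeff_C_mul, coeff_C_mul, coeff_vertexPoly]
  cases k with
  | zero => simp [explicitProb_zero_right, hn.ne']
  | succ k =>
    rw [coeff_X_mul, finsetSum_coeff, explicitProb_succ, Finset.mul_sum, Finset.mul_sum]
    refine Finset.sum_congr rfl fun m _ => ?_
    rw [coeff_C_mul, coeff_vertexPoly]
    field_simp

theorem sum_explicitProb (n : ℕ) : ∑ k ∈ Finset.range (n + 1), explicitProb n k = 1 := by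
  have heval : ∀ n, ∑ k ∈ Finset.range (n + 1), explicitProb n k = (vertexPoly n).eval 1 := by
    intro n
    simp [vertexPoly, Polynomial.eval_finsetSum]
  rw [heval]
  induction n using Nat.strong_induction_on with
  | _ n ih =>
    rcases Nat.eq_zero_or_pos n with rfl | hn
    · simp [vertexPoly_zero]
    have hn' : (0 : ℝ) < n := by exact_mod_cast hn
    have h := congrArg (Polynomial.eval 1) (vertexPoly_recursion n)
    simp only [Polynomial.eval_mul, Polynomial.eval_C, Polynomial.eval_X, Polynomial.eval_ofNat,
      Polynomial.eval_finsetSum] at h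
    have hsum : ∑ m ∈ Finset.range n, ((n : ℝ) - m) * (vertexPoly m).eval 1
        = ∑ m ∈ Finset.range n, ((n : ℝ) - m) :=
      Finset.sum_congr rfl fun m hm => by rw [ih m (Finset.mem_range.1 hm), mul_one]
    rw [hsum] at h
    -- Gauss summation: the weights of the recursion sum to `1`.
    have hg : ∀ n : ℕ, 2 * ∑ m ∈ Finset.range n, ((n : ℝ) - m) = n * (n + 1) := by
      intro n
      induction n with
      | zero => simp
      | succ n ihn =>
        rw [Finset.sum_range_succ]
        simp only [Finset.sum_sub_distrib, Finset.sum_const, Finset.card_range,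
          nsmul_eq_mul] at ihn ⊢
        push_cast
        linarith
    rw [mul_one, hg] at h
    exact mul_left_cancel₀ (by positivity) (h.trans (mul_one _).symm)

open Polynomial in
/-- Every complex root of `vertexPoly n` is real and non-positive. -/
theorem root_vertexPoly (n : ℕ) (z : ℂ) (hz : aeval z (vertexPoly n) = 0) :
    ∃ r : ℝ, 0 ≤ r ∧ z = -(r : ℂ) := by
  rcases eq_or_ne z 0 with rfl | hz0
  · exact ⟨0, le_rfl, by simp⟩
  set g : ℕ → ℂ := fun m => aeval z (vertexPoly m) with hg
  set F : ℕ → ℂ := fun m => (m * (m + 1) : ℝ) * g m with hF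
  have hrec : ∀ n, F n = 2 * z * ∑ m ∈ Finset.range n, ((n : ℂ) - m) * g m := by
    intro n
    have h := congrArg (aeval z) (vertexPoly_recursion n)
    simp only [map_mul, map_sum, aeval_C, aeval_X, map_ofNat, Complex.coe_algebraMap] at h
    simp only [hF, hg]
    push_cast at h ⊢
    exact h
  have hdiff : ∀ n, F (n + 1) - F n = 2 * z * ∑ m ∈ Finset.range (n + 1), g m := by
    intro n
    rw [hrec, hrec, ← mul_sub, Finset.sum_range_succ, add_sub_right_comm, ← Finset.sum_sub_distrib,
      Finset.sum_range_succ _ n]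
    push_cast
    congr 2
    · exact Finset.sum_congr rfl fun m _ => by ring
    · ring
  have hdiff2 : ∀ n, (F (n + 2) - F (n + 1)) - (F (n + 1) - F n) = 2 * z * g (n + 1) := by
    intro n
    rw [hdiff, hdiff, Finset.sum_range_succ _ (n + 1)]
    ring
  have hF0 : F 0 = 0 := by simp [hF]
  have hF1 : F 1 = 2 * z := by
    have := hdiff 0
    simpa [hF0, hg, vertexPoly_zero] using this
  set A : ℕ → ℝ := fun N => ∑ m ∈ Finset.range N, Complex.normSq (F (m + 1) - F m) with hA
  set B : ℕ → ℝ := fun N =>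
    ∑ m ∈ Finset.range N, ((m + 1 : ℕ) * ((m + 1 : ℕ) + 1)) * Complex.normSq (g (m + 1)) with hB
  -- Summation by parts; at `F (N + 1) = 0` it exhibits `z` as a quotient of real numbers.
  have hparts : ∀ N, (A (N + 1) : ℂ) + 2 * z * B N
      = (F (N + 1) - F N) * starRingEnd ℂ (F (N + 1)) := by
    intro N
    induction N with
    | zero => simp [hA, hB, hF0, ← Complex.mul_conj]
    | succ N ih =>
      have h1 : A (N + 2) = A (N + 1) + Complex.normSq (F (N + 2) - F (N + 1)) :=
        Finset.sum_range_succ _ _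
      have h2 : (B (N + 1) : ℂ) = B N + g (N + 1) * starRingEnd ℂ (F (N + 1)) := by
        simp only [hB, Finset.sum_range_succ _ N, hF, map_mul, Complex.conj_ofReal]
        push_cast
        rw [← Complex.mul_conj]
        ring
      rw [h1, h2]
      push_cast
      rw [← Complex.mul_conj, map_sub]
      linear_combination ih + starRingEnd ℂ (F (N + 1)) * (- hdiff2 N)
  cases n with
  | zero => simp [vertexPoly_zero] at hz
  | succ N =>
    have hFN : F (N + 1) = 0 := by simp only [hF, hg, hz, mul_zero]
    have h := hparts N
    rw [hFN, map_zero, mul_zero] at h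
    have hApos : 0 < A (N + 1) := by
      refine Finset.sum_pos' (fun m _ => Complex.normSq_nonneg _) ⟨0, by simp, ?_⟩
      simp [hF0, hF1, hz0]
    have hBnonneg : 0 ≤ B N :=
      Finset.sum_nonneg fun m _ => mul_nonneg (by positivity) (Complex.normSq_nonneg _)
    have hBne : B N ≠ 0 := by
      intro h0
      rw [h0] at h
      simp at h
      exact hApos.ne' (by exact_mod_cast h)
    refine ⟨A (N + 1) / (2 * B N), by positivity, ?_⟩
    have hBc : (B N : ℂ) ≠ 0 := by exact_mod_cast hBne
    push_cast
    field_simp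
    linear_combination h

theorem isPolyaFrequency_explicitProb (n : ℕ) : IsPolyaFrequency (explicitProb n) := by
  refine ⟨explicitProb_nonneg n, ?_⟩
  rw [← funext (coeff_vertexPoly n)]
  refine isTotallyPositive_toeplitz_of_roots _ ?_ (root_vertexPoly n)
  rw [Polynomial.leadingCoeff, coeff_vertexPoly]
  exact explicitProb_nonneg n _

/-! ### Vertices of chains -/

/-- The direction from right to left is the Krein–Milman theorem: if `w` were not extreme, then the
convex hull would be spanned by extreme points in `S \ {w}`. -/
theorem mem_extremePoints_convexHull_iff {E : Type*} [AddCommGroup E] [Module ℝ E]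
    [TopologicalSpace E] [T2Space E] [IsTopologicalAddGroup E] [ContinuousSMul ℝ E]
    [LocallyConvexSpace ℝ E] {S : Set E} (hS : S.Finite) {w : E} :
    w ∈ (convexHull ℝ S).extremePoints ℝ ↔ w ∈ S ∧ w ∉ convexHull ℝ (S \ {w}) := by
  constructor
  · intro h
    refine ⟨extremePoints_convexHull_subset h, fun hw => ?_⟩
    have hconv := ((convex_convexHull ℝ S).mem_extremePoints_iff_convex_sdiff.1 h).2
    exact (convexHull_min (Set.sdiff_subset_sdiff_left (subset_convexHull ℝ S)) hconv hw).2 rfl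
  · rintro ⟨hwS, hw⟩
    by_contra hext
    have hsub : (convexHull ℝ S).extremePoints ℝ ⊆ S \ {w} := fun u hu =>
      ⟨extremePoints_convexHull_subset hu, by rintro rfl; exact hext hu⟩
    have hkm := closure_convexHull_extremePoints (hS.isCompact_convexHull ℝ) (convex_convexHull ℝ S)
    have hfin : ((convexHull ℝ S).extremePoints ℝ).Finite := hS.subset (hsub.trans Set.sdiff_subset)
    rw [(hfin.isClosed_convexHull ℝ).closure_eq] at hkm
    exact hw (convexHull_mono hsub (hkm.symm ▸ subset_convexHull ℝ S hwS : w ∈ convexHull ℝ _))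

/-- The points of `Y` that are vertices of the convex hull of `Y ∪ {A, B}`. -/
def freeVertices (Y : Set (ℝ × ℝ)) (A B : ℝ × ℝ) : Set (ℝ × ℝ) :=
  {w ∈ Y | w ∉ convexHull ℝ (Y \ {w} ∪ {A, B})}

/-- The open triangle with vertices `(0,0)`, `(0,1)` and `(1,0)`. -/
def openTriangle : Set (ℝ × ℝ) := {p | 0 < p.1 ∧ 0 < p.2 ∧ p.1 + p.2 < 1}

theorem vertexCount_eq_ncard_freeVertices {n : ℕ} {x : Fin n → ℝ × ℝ}
    (hx : ∀ i, x i ∈ openTriangle) :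
    vertexCount x = (freeVertices (Set.range x) (0, 1) (1, 0)).ncard := by
  have hfin : (Set.range x ∪ {((0 : ℝ), (1 : ℝ)), (1, 0)}).Finite :=
    (Set.finite_range x).union (Set.toFinite _)
  have hne : ∀ w ∈ Set.range x, w ∉ ({((0 : ℝ), (1 : ℝ)), (1, 0)} : Set (ℝ × ℝ)) := by
    rintro _ ⟨i, rfl⟩ h
    have := hx i
    rcases h with h | (h : _ = _) <;> simp [openTriangle, h] at this
  unfold vertexCount chain freeVertices
  congr 1
  ext w
  rw [Set.mem_sdiff, mem_extremePoints_convexHull_iff hfin, Set.mem_sep_iff]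
  have key : ∀ w ∈ Set.range x, (Set.range x ∪ {((0 : ℝ), (1 : ℝ)), (1, 0)}) \ {w}
      = Set.range x \ {w} ∪ {(0, 1), (1, 0)} := by
    intro w hw
    rw [Set.union_sdiff_distrib, Set.sdiff_singleton_eq_self (hne w hw)]
  constructor
  · rintro ⟨⟨hw | hw, hw'⟩, hw2⟩
    · exact ⟨hw, key w hw ▸ hw'⟩
    · exact absurd hw hw2
  · rintro ⟨hw, hw'⟩
    exact ⟨⟨Or.inl hw, (key w hw).symm ▸ hw'⟩, hne w hw⟩

theorem freeVertices_image {f : ℝ × ℝ →ᵃ[ℝ] ℝ × ℝ} (hf : Function.Injective f)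
    (Y : Set (ℝ × ℝ)) (A B : ℝ × ℝ) :
    freeVertices (f '' Y) (f A) (f B) = f '' freeVertices Y A B := by
  have key : ∀ w, f w ∈ convexHull ℝ (f '' Y \ {f w} ∪ {f A, f B}) ↔
      w ∈ convexHull ℝ (Y \ {w} ∪ {A, B}) := by
    intro w
    rw [← hf.mem_set_image (s := convexHull ℝ (Y \ {w} ∪ {A, B})), AffineMap.image_convexHull,
      Set.image_union, Set.image_sdiff hf, Set.image_singleton, Set.image_pair]
  ext u
  constructor
  · rintro ⟨⟨w, hw, rfl⟩, hu⟩
    exact ⟨w, ⟨hw, (key w).not.1 hu⟩, rfl⟩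
  · rintro ⟨w, ⟨hw, hu⟩, rfl⟩
    exact ⟨⟨w, hw, rfl⟩, (key w).not.2 hu⟩

/-- The affine map `(u, v) ↦ (a u + b v + e, c u + d v + f)` of the plane. -/
def planeAffineMap (a b c d e f : ℝ) : ℝ × ℝ →ᵃ[ℝ] ℝ × ℝ :=
  (Matrix.toLin (Module.Basis.finTwoProd ℝ) (Module.Basis.finTwoProd ℝ) !![a, b; c, d]).toAffineMap
    + AffineMap.const ℝ (ℝ × ℝ) (e, f)

theorem planeAffineMap_apply (a b c d e f : ℝ) (p : ℝ × ℝ) :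
    planeAffineMap a b c d e f p = (a * p.1 + b * p.2 + e, c * p.1 + d * p.2 + f) := by
  simp [planeAffineMap]

theorem planeAffineMap_injective {a b c d : ℝ} (h : a * d - b * c ≠ 0) (e f : ℝ) :
    Function.Injective (planeAffineMap a b c d e f) := by
  intro p q hpq
  simp only [planeAffineMap_apply, Prod.mk.injEq] at hpq
  obtain ⟨h1, h2⟩ := hpq
  ext
  · refine mul_left_cancel₀ h ?_
    linear_combination d * h1 - b * h2
  · refine mul_left_cancel₀ h ?_
    linear_combination a * h2 - c * h1

/-- The affine map that fixes `(0,1)`, sends `v` to `(1,0)`, and sends to the origin the point where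
the line through `(1,0)` and `v` meets the vertical axis. -/
def farMap (v : ℝ × ℝ) : ℝ × ℝ →ᵃ[ℝ] ℝ × ℝ :=
  planeAffineMap (1 / v.1) 0 (v.2 / (1 - v.1 - v.2)) ((1 - v.1) / (1 - v.1 - v.2)) 0
    (-v.2 / (1 - v.1 - v.2))

/-- The affine map that fixes `(0,1)` and `(1,0)` and sends `v` to the origin. -/
def nearMap (v : ℝ × ℝ) : ℝ × ℝ →ᵃ[ℝ] ℝ × ℝ :=
  planeAffineMap (1 + v.1 / (1 - v.1 - v.2)) (v.1 / (1 - v.1 - v.2)) (v.2 / (1 - v.1 - v.2))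
    (1 + v.2 / (1 - v.1 - v.2)) (-v.1 / (1 - v.1 - v.2)) (-v.2 / (1 - v.1 - v.2))

theorem farMap_apply (v p : ℝ × ℝ) : farMap v p =
    (p.1 / v.1, ((1 - v.1) * p.2 - v.2 * (1 - p.1)) / (1 - v.1 - v.2)) := by
  rw [farMap, planeAffineMap_apply]
  ext <;> dsimp only <;> ring

theorem nearMap_apply (v p : ℝ × ℝ) : nearMap v p =
    (p.1 - (1 - p.1 - p.2) / (1 - v.1 - v.2) * v.1,
      p.2 - (1 - p.1 - p.2) / (1 - v.1 - v.2) * v.2) := by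
  rw [nearMap, planeAffineMap_apply]
  ext <;> dsimp only <;> ring

section
variable {v : ℝ × ℝ}

theorem farMap_det_pos (hv : v ∈ openTriangle) :
    0 < 1 / v.1 * ((1 - v.1) / (1 - v.1 - v.2)) - 0 * (v.2 / (1 - v.1 - v.2)) := by
  obtain ⟨hx, hy, hxy⟩ := hv
  have h1 : 0 < 1 - v.1 - v.2 := by linarith
  have h2 : 0 < 1 - v.1 := by linarith
  rw [zero_mul, sub_zero]
  positivity

theorem farMap_injective (hv : v ∈ openTriangle) : Function.Injective (farMap v) :=
  planeAffineMap_injective (farMap_det_pos hv).ne' _ _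

theorem farMap_self (hv : v ∈ openTriangle) : farMap v v = (1, 0) := by
  rw [farMap_apply]
  obtain ⟨hx, hy, hxy⟩ := hv
  ext
  · simp [hx.ne']
  · dsimp only; ring

theorem farMap_zero_one (hv : v ∈ openTriangle) : farMap v (0, 1) = (0, 1) := by
  rw [farMap_apply]
  obtain ⟨hx, hy, hxy⟩ := hv
  have h1 : 1 - v.1 - v.2 ≠ 0 := by linarith
  ext
  · simp
  · simp [h1]

theorem farMap_one_zero : farMap v (1, 0) = (1 / v.1, 0) := by
  rw [farMap_apply]
  ext <;> simp

/-- The affine function of `p`, up to scaling, that vanishes on the line through `v` and `(1,0)` and is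
positive above it. -/
def sightValue (v p : ℝ × ℝ) : ℝ := (1 - v.1) * p.2 - v.2 * (1 - p.1)

theorem sightValue_pos_of_farMap_mem (hv : v ∈ openTriangle) {p : ℝ × ℝ}
    (hp : farMap v p ∈ openTriangle) : 0 < sightValue v p := by
  obtain ⟨hx, hy, hxy⟩ := hv
  rw [farMap_apply] at hp
  exact (div_pos_iff_of_pos_right (by linarith)).1 hp.2.1

theorem sightValue_pos_of_nearMap_mem (hv : v ∈ openTriangle) {p : ℝ × ℝ}
    (hp : nearMap v p ∈ openTriangle) : 0 < sightValue v p := by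
  obtain ⟨hx, hy, hxy⟩ := hv
  rw [nearMap_apply] at hp
  obtain ⟨h1, h2, h3⟩ := hp
  dsimp only at h1 h2 h3
  have hs : 0 < 1 - v.1 - v.2 := by linarith
  have hk : (1 - p.1 - p.2) / (1 - v.1 - v.2) * (1 - v.1 - v.2) = 1 - p.1 - p.2 :=
    div_mul_cancel₀ _ hs.ne'
  set k := (1 - p.1 - p.2) / (1 - v.1 - v.2)
  have : sightValue v p = (p.2 - k * v.2) * (1 - v.1 - v.2) := by
    unfold sightValue
    linear_combination v.2 * hk
  rw [this]
  positivity

/-- The preimages of the open triangle under `farMap v` and `nearMap v` are disjoint: the line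
through `v` and `(0,1)` separates them. -/
theorem farMap_notMem_of_nearMap_mem (hv : v ∈ openTriangle) {p : ℝ × ℝ}
    (hp : nearMap v p ∈ openTriangle) : farMap v p ∉ openTriangle := by
  obtain ⟨hx, hy, hxy⟩ := hv
  rintro ⟨-, -, h⟩
  rw [nearMap_apply] at hp
  rw [farMap_apply] at h
  obtain ⟨h1, h2, h3⟩ := hp
  dsimp only at h1 h2 h3 h
  have hs : 0 < 1 - v.1 - v.2 := by linarith
  rw [div_add_div _ _ hx.ne' hs.ne', div_lt_one (by positivity)] at h
  have hk : (1 - p.1 - p.2) / (1 - v.1 - v.2) * (1 - v.1 - v.2) = 1 - p.1 - p.2 :=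
    div_mul_cancel₀ _ hs.ne'
  set k := (1 - p.1 - p.2) / (1 - v.1 - v.2)
  have : 0 < (p.1 - k * v.1) * ((1 - v.1) * (1 - v.1 - v.2)) :=
    mul_pos h1 (mul_pos (by linarith) hs)
  have heq : (p.1 - k * v.1) * ((1 - v.1) * (1 - v.1 - v.2)) =
      p.1 * (1 - v.1 - v.2) + v.1 * ((1 - v.1) * p.2 - v.2 * (1 - p.1))
        - v.1 * (1 - v.1 - v.2) := by
    linear_combination (-(1 - v.1) * v.1) * hk
  linarith

theorem mem_convexHull_of_nearMap_mem (hv : v ∈ openTriangle) {p : ℝ × ℝ}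
    (hp : nearMap v p ∈ openTriangle) : p ∈ convexHull ℝ {v, (0, 1), (1, 0)} := by
  obtain ⟨hx, hy, hxy⟩ := hv
  rw [nearMap_apply] at hp
  obtain ⟨h1, h2, h3⟩ := hp
  dsimp only at h1 h2 h3
  have hs : 0 < 1 - v.1 - v.2 := by linarith
  have hk : (1 - p.1 - p.2) / (1 - v.1 - v.2) * (1 - v.1 - v.2) = 1 - p.1 - p.2 :=
    div_mul_cancel₀ _ hs.ne'
  set k := (1 - p.1 - p.2) / (1 - v.1 - v.2)
  have hk0 : 0 ≤ k := by nlinarith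
  have hsum := (convex_convexHull ℝ {v, ((0 : ℝ), (1 : ℝ)), (1, 0)}).sum_mem
    (t := Finset.univ) (w := ![k, p.2 - k * v.2, p.1 - k * v.1])
    (z := ![v, ((0 : ℝ), (1 : ℝ)), (1, 0)])
    (by intro i _; fin_cases i <;> simp <;> linarith)
    (by simp [Fin.sum_univ_three]; linarith)
    (by intro i _; apply subset_convexHull; fin_cases i <;> simp)
  convert hsum using 1
  ext <;> simp [Fin.sum_univ_three]

/-- A convex set `C` in the triangle that contains its hypotenuse gains, on adjoining a point
`(q, 0)` outside the triangle, only points beyond the hypotenuse. -/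
theorem mem_of_mem_convexHull_insert {C : Set (ℝ × ℝ)} (hC : Convex ℝ C)
    (hCT : ∀ p ∈ C, 0 ≤ p.1 ∧ 0 ≤ p.2 ∧ p.1 + p.2 ≤ 1) (hP : (0, 1) ∈ C) (hQ : (1, 0) ∈ C)
    {q : ℝ} (hq : 1 < q) {w : ℝ × ℝ} (hw : w.1 + w.2 ≤ 1)
    (h : w ∈ convexHull ℝ (insert (q, 0) C)) : w ∈ C := by
  rw [convexHull_insert ⟨_, hP⟩, hC.convexHull_eq, mem_convexJoin] at h
  obtain ⟨a, rfl, c, hc, s, t, hs, ht, hst, rfl⟩ := h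
  obtain ⟨hc1, hc2, hc3⟩ := hCT c hc
  simp only [Prod.smul_mk, smul_eq_mul, mul_zero, Prod.fst_add, Prod.snd_add, Prod.smul_fst,
    Prod.smul_snd, zero_add] at hw
  set α := 1 - c.1 - c.2 with hα
  have hδ : s * (q - 1) ≤ t * α := by rw [hα]; linarith
  -- `α`, `c.2`, `c.1` are the barycentric coordinates of `c` in the triangle. For `α > 0`, the point
  -- `(q, 0)` is eliminated in favour of `c`, `(0, 1)` and `(1, 0)`.
  rcases (show 0 ≤ α by linarith).eq_or_lt with h0 | h0
  · have hs0 : s = 0 := by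
      rw [← h0, mul_zero] at hδ
      nlinarith
    subst hs0
    obtain rfl : t = 1 := by linarith
    simpa using hc
  · have he : s * (q - 1) / α ≤ t := (div_le_iff₀ h0).2 hδ
    have he0 : 0 ≤ s * (q - 1) / α := div_nonneg (mul_nonneg hs (by linarith)) h0.le
    have hea : s * (q - 1) / α * α = s * (q - 1) := div_mul_cancel₀ _ h0.ne'
    set ε := s * (q - 1) / α
    have hsum := hC.sum_mem
      (t := Finset.univ) (w := ![t - ε, ε * c.2, ε * c.1 + s * q])
      (z := ![c, ((0 : ℝ), (1 : ℝ)), (1, 0)])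
      (by
        have h1 : 0 ≤ ε * c.2 := mul_nonneg he0 hc2
        have h2 : 0 ≤ ε * c.1 + s * q := by
          have := mul_nonneg he0 hc1
          have := mul_nonneg hs (show 0 ≤ q by linarith)
          linarith
        intro i _; fin_cases i <;> simp <;> linarith)
      (by
        simp only [Fin.sum_univ_three, Matrix.cons_val]
        rw [hα] at hea
        linear_combination hst - hea)
      (by intro i _; fin_cases i <;> simp [hc, hP, hQ])
    convert hsum using 1
    ext <;> simp [Fin.sum_univ_three] <;> ring

theorem openTriangle_subset_closed {p : ℝ × ℝ} (hp : p ∈ openTriangle) :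
    0 ≤ p.1 ∧ 0 ≤ p.2 ∧ p.1 + p.2 ≤ 1 := ⟨hp.1.le, hp.2.1.le, hp.2.2.le⟩

theorem convex_closedTriangle : Convex ℝ {p : ℝ × ℝ | 0 ≤ p.1 ∧ 0 ≤ p.2 ∧ p.1 + p.2 ≤ 1} := by
  rintro p ⟨h1, h2, h3⟩ q ⟨h1', h2', h3'⟩ a b ha hb hab
  refine ⟨?_, ?_, ?_⟩
  · simp; positivity
  · simp; positivity
  · simp only [Prod.fst_add, Prod.snd_add, Prod.smul_fst, Prod.smul_snd, smul_eq_mul]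
    nlinarith

/-- If every point of `Z` lies strictly above the line through `v` and `(1,0)`, then `v` does not
lie in the convex hull of `Z`, `(0,1)` and `(1,0)`. -/
theorem notMem_convexHull_of_sightValue_pos (hv : v ∈ openTriangle) {Z : Set (ℝ × ℝ)}
    (hZ : ∀ p ∈ Z, 0 < sightValue v p) : v ∉ convexHull ℝ (Z ∪ {(0, 1), (1, 0)}) := by
  obtain ⟨hx, hy, hxy⟩ := hv
  intro h
  have hset : Z ∪ {((0 : ℝ), (1 : ℝ)), (1, 0)} = insert (1, 0) (insert (0, 1) Z) := by
    ext p; simp; tauto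
  rw [hset, convexHull_insert ⟨_, Set.mem_insert _ _⟩, mem_convexJoin] at h
  obtain ⟨a, rfl, c, hc, s, t, hs, ht, hst, hsum⟩ := h
  have hpos : 0 < sightValue v c := by
    have hconv : Convex ℝ {p | 0 < sightValue v p} := by
      intro p hp q hq a b ha hb hab
      have : sightValue v (a • p + b • q) = a * sightValue v p + b * sightValue v q := by
        simp only [sightValue, Prod.fst_add, Prod.snd_add, Prod.smul_fst, Prod.smul_snd,
          smul_eq_mul]
        linear_combination (-v.2) * (-hab)
      simp only [Set.mem_ofPred_eq] at hp hq ⊢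
      rw [this]
      rcases ha.eq_or_lt with rfl | ha
      · obtain rfl : b = 1 := by linarith
        linarith
      · have := mul_pos ha hp
        have := mul_nonneg hb hq.le
        linarith
    refine convexHull_min ?_ hconv hc
    rintro p (rfl | hp)
    · simp [sightValue]; linarith
    · exact hZ p hp
  have h1 := congrArg Prod.fst hsum
  have h2 := congrArg Prod.snd hsum
  simp at h1 h2
  unfold sightValue at hpos
  have h0 : t * ((1 - v.1) * c.2 - v.2 * (1 - c.1)) = 0 := by
    linear_combination (1 - v.1) * h2 + v.2 * h1 - v.2 * hst
  rcases mul_eq_zero.1 h0 with rfl | h0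
  · obtain rfl : s = 1 := by linarith
    linarith
  · linarith

/-- The free vertices of a configuration are `v`, the point of least angle seen from `(1,0)`, and the
free vertices of the chain from `(0,1)` to `v` spanned by the points beyond `v`. -/
theorem freeVertices_insert_union (hv : v ∈ openTriangle) {Y R : Set (ℝ × ℝ)}
    (hY : ∀ p ∈ Y, farMap v p ∈ openTriangle) (hR : ∀ p ∈ R, nearMap v p ∈ openTriangle) :
    freeVertices (insert v (Y ∪ R)) (0, 1) (1, 0) = insert v (freeVertices Y (0, 1) v) := by
  have hpos : ∀ p ∈ Y ∪ R, 0 < sightValue v p := by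
    rintro p (hp | hp)
    · exact sightValue_pos_of_farMap_mem hv (hY p hp)
    · exact sightValue_pos_of_nearMap_mem hv (hR p hp)
  have hself : sightValue v v = 0 := by unfold sightValue; ring
  have hne : ∀ p ∈ Y ∪ R, p ≠ v := by
    rintro p hp rfl
    exact (hpos p hp).ne' hself
  ext w
  constructor
  · rintro ⟨rfl | hw | hw, hconv⟩
    · exact Or.inl rfl
    · refine Or.inr ⟨hw, fun h => hconv (convexHull_min ?_ (convex_convexHull ℝ _) h)⟩
      rintro p (⟨hp, hpw⟩ | rfl | rfl) <;> apply subset_convexHull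
      · exact Or.inl ⟨Or.inr (Or.inl hp), hpw⟩
      · simp
      · exact Or.inl ⟨Or.inl rfl, (hne w (Or.inl hw)).symm⟩
    · refine absurd (convexHull_mono ?_ (mem_convexHull_of_nearMap_mem hv (hR w hw))) hconv
      rintro p (rfl | hp)
      · exact Or.inl ⟨Or.inl rfl, (hne w (Or.inr hw)).symm⟩
      · exact Or.inr hp
  · rintro (rfl | ⟨hw, hconv⟩)
    · refine ⟨Or.inl rfl, notMem_convexHull_of_sightValue_pos hv ?_⟩
      rintro p ⟨rfl | hp, hpw⟩
      · exact absurd rfl hpw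
      · exact hpos p hp
    · refine ⟨Or.inr (Or.inl hw), fun h => hconv ?_⟩
      set C := convexHull ℝ (Y \ {w} ∪ {(0, 1), v}) with hCdef
      have hsub : convexHull ℝ (insert v (Y ∪ R) \ {w} ∪ {(0, 1), (1, 0)})
          ⊆ convexHull ℝ (insert (1, 0) C) := by
        have hvC : v ∈ C := subset_convexHull ℝ _ (by simp)
        have hPC : ((0 : ℝ), (1 : ℝ)) ∈ C := subset_convexHull ℝ _ (by simp)
        refine convexHull_min ?_ (convex_convexHull ℝ _)
        rintro p (⟨rfl | hp | hp, hpw⟩ | rfl | rfl)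
        · exact subset_convexHull ℝ _ (Or.inr hvC)
        · exact subset_convexHull ℝ _ (Or.inr (subset_convexHull ℝ _ (Or.inl ⟨hp, hpw⟩)))
        · refine convexHull_mono ?_ (mem_convexHull_of_nearMap_mem hv (hR p hp))
          rintro u (rfl | rfl | rfl)
          · exact Or.inr hvC
          · exact Or.inr hPC
          · exact Or.inl rfl
        · exact subset_convexHull ℝ _ (Or.inr hPC)
        · exact subset_convexHull ℝ _ (Or.inl rfl)
      have hK := Set.mem_image_of_mem (farMap v) (hsub h)
      rw [AffineMap.image_convexHull, Set.image_insert_eq, farMap_one_zero, hCdef,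
        AffineMap.image_convexHull, Set.image_union, Set.image_pair, farMap_self hv,
        farMap_zero_one hv] at hK
      have hwT := hY w hw
      have hfin := mem_of_mem_convexHull_insert (convex_convexHull ℝ _)
        (convexHull_min ?_ convex_closedTriangle) (subset_convexHull ℝ _ (by simp))
        (subset_convexHull ℝ _ (by simp)) ?_ hwT.2.2.le hK
      · rw [← farMap_self hv, ← farMap_zero_one hv] at hfin
        have hfin' : farMap v w ∈ farMap v '' C := by
          rw [hCdef, AffineMap.image_convexHull, Set.image_union, Set.image_pair]
          convert hfin using 4
        exact (farMap_injective hv).mem_set_image.1 hfin'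
      · rintro p (⟨u, hu, rfl⟩ | rfl | rfl)
        · exact openTriangle_subset_closed (hY u hu.1)
        · exact ⟨by norm_num, by norm_num, by norm_num⟩
        · exact ⟨by norm_num, by norm_num, by norm_num⟩
      · obtain ⟨hx, hy, hxy⟩ := hv
        exact (one_lt_div hx).2 (by linarith)

theorem ncard_freeVertices_insert_union (hv : v ∈ openTriangle) {Y R : Set (ℝ × ℝ)}
    (hfin : Y.Finite) (hY : ∀ p ∈ Y, farMap v p ∈ openTriangle)
    (hR : ∀ p ∈ R, nearMap v p ∈ openTriangle) :
    (freeVertices (insert v (Y ∪ R)) (0, 1) (1, 0)).ncard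
      = (freeVertices (farMap v '' Y) (0, 1) (1, 0)).ncard + 1 := by
  have h := freeVertices_image (farMap_injective hv) Y (0, 1) v
  rw [farMap_self hv, farMap_zero_one hv] at h
  rw [freeVertices_insert_union hv hY hR, h, Set.ncard_image_of_injective _ (farMap_injective hv),
    Set.ncard_insert_of_notMem _ (hfin.subset fun _ hw => hw.1)]
  rintro ⟨hvY, -⟩
  have := hY v hvY
  rw [farMap_self hv] at this
  simp [openTriangle] at this

end

/-! ### Volumes in the triangle -/

theorem volume_preimage_planeAffineMap {a b c d : ℝ} (h : a * d - b * c ≠ 0) (e f : ℝ)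
    (s : Set (ℝ × ℝ)) :
    volume (planeAffineMap a b c d e f ⁻¹' s)
      = ENNReal.ofReal |(a * d - b * c)⁻¹| * volume s := by
  set M : ℝ × ℝ →ₗ[ℝ] ℝ × ℝ :=
    Matrix.toLin (Module.Basis.finTwoProd ℝ) (Module.Basis.finTwoProd ℝ) !![a, b; c, d] with hM
  have hdet : LinearMap.det M = a * d - b * c := by
    rw [hM, LinearMap.det_toLin, Matrix.det_fin_two_of]
  have hpre : planeAffineMap a b c d e f ⁻¹' s = M ⁻¹' ((fun p => p + (e, f)) ⁻¹' s) := rfl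
  rw [hpre, Measure.addHaar_preimage_linearMap _ (by rwa [hdet]), hdet, measure_preimage_add_right]

theorem measurable_planeAffineMap (a b c d e f : ℝ) : Measurable (planeAffineMap a b c d e f) := by
  have : ⇑(planeAffineMap a b c d e f)
      = fun p => (a * p.1 + b * p.2 + e, c * p.1 + d * p.2 + f) :=
    funext (planeAffineMap_apply a b c d e f)
  rw [this]
  fun_prop

/-- A map that scales the volume by `c` scales the volume of sets of configurations by a power of
`c` when applied to each point. -/
theorem volume_pi_preimage_of_scaling {ι E : Type*} [Fintype ι] [MeasureSpace E]
    [SigmaFinite (volume : Measure E)] {f : E → E} (hf : Measurable f) {c : NNReal}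
    (h : ∀ s : Set E, volume (f ⁻¹' s) = c * volume s) {D : Set (ι → E)} (hD : MeasurableSet D) :
    volume ((fun (y : ι → E) i => f (y i)) ⁻¹' D) = (c : ENNReal) ^ Fintype.card ι * volume D := by
  have hmap : (volume : Measure E).map f = c • volume := by
    ext s hs
    rw [Measure.map_apply hf hs, h, Measure.smul_apply, ENNReal.smul_def, smul_eq_mul]
  have hsf : SigmaFinite ((volume : Measure E).map f) := by rw [hmap]; infer_instance
  have hpi := Measure.pi_map_pi (ι := ι) (μ := fun _ => (volume : Measure E)) (f := fun _ => f)
    fun _ => hf.aemeasurable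
  have hsmul : Measure.pi (fun _ : ι => (volume : Measure E).map f)
      = ((c : ENNReal) ^ Fintype.card ι) • (volume : Measure (ι → E)) := by
    refine Measure.pi_eq fun s hs => ?_
    rw [Measure.smul_apply, volume_pi_pi, hmap, smul_eq_mul]
    simp only [Measure.smul_apply, ENNReal.smul_def, smul_eq_mul, Finset.prod_mul_distrib,
      Finset.prod_const, Finset.card_univ]
  rw [hsmul] at hpi
  have := congrArg (fun ν => ν D) hpi
  simp only [Measure.smul_apply, smul_eq_mul] at this
  rw [← this, Measure.map_apply (by fun_prop) hD, volume_pi]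

/-- The Beta integral at natural exponents. -/
theorem integral_pow_mul_one_sub_pow (a b : ℕ) :
    ∫ x in (0 : ℝ)..1, x ^ b * (1 - x) ^ a
      = (b.factorial * a.factorial : ℝ) / (a + b + 1).factorial := by
  induction a generalizing b with
  | zero =>
    simp [integral_pow, Nat.factorial_succ]
    field_simp
  | succ a ih =>
    have hsplit : ∀ x : ℝ, x ^ b * (1 - x) ^ (a + 1)
        = x ^ b * (1 - x) ^ a - x ^ (b + 1) * (1 - x) ^ a := fun x => by ring
    simp only [hsplit]
    rw [intervalIntegral.integral_sub (by apply Continuous.intervalIntegrable; fun_prop)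
      (by apply Continuous.intervalIntegrable; fun_prop), ih, ih]
    rw [show a + (b + 1) + 1 = (a + b + 1) + 1 by ring, show a + 1 + b + 1 = (a + b + 1) + 1 by ring,
      Nat.factorial_succ (a + b + 1), Nat.factorial_succ b, Nat.factorial_succ a]
    push_cast
    field_simp
    ring

theorem setLIntegral_Ioo_ofReal {f : ℝ → ℝ} (hf : Continuous f) {a b : ℝ} (hab : a ≤ b)
    (hpos : ∀ x ∈ Set.Ioo a b, 0 ≤ f x) :
    ∫⁻ x in Set.Ioo a b, ENNReal.ofReal (f x) = ENNReal.ofReal (∫ x in a..b, f x) := by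
  rw [intervalIntegral.integral_of_le hab, integral_Ioc_eq_integral_Ioo,
    ofReal_integral_eq_lintegral_ofReal]
  · exact (hf.integrableOn_Icc).mono_set Set.Ioo_subset_Icc_self
  · exact (ae_restrict_iff' measurableSet_Ioo).2 (Filter.Eventually.of_forall hpos)

theorem isOpen_openTriangle : IsOpen openTriangle := by
  refine (isOpen_lt continuous_const continuous_fst).inter
    ((isOpen_lt continuous_const continuous_snd).inter ?_)
  exact isOpen_lt (continuous_fst.add continuous_snd) continuous_const

theorem measurableSet_openTriangle : MeasurableSet openTriangle :=
  isOpen_openTriangle.measurableSet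

theorem setLIntegral_openTriangle {F : ℝ × ℝ → ENNReal} (hF : Measurable F) :
    ∫⁻ v in openTriangle, F v
      = ∫⁻ x in Set.Ioo (0 : ℝ) 1, ∫⁻ y in Set.Ioo 0 (1 - x), F (x, y) := by
  rw [← lintegral_indicator measurableSet_openTriangle, Measure.volume_eq_prod,
    lintegral_prod _ (hF.indicator measurableSet_openTriangle).aemeasurable,
    ← lintegral_indicator measurableSet_Ioo]
  refine lintegral_congr fun x => ?_
  by_cases hx : x ∈ Set.Ioo (0 : ℝ) 1
  · rw [Set.indicator_of_mem hx, ← lintegral_indicator measurableSet_Ioo]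
    refine lintegral_congr fun y => ?_
    have : (x, y) ∈ openTriangle ↔ y ∈ Set.Ioo 0 (1 - x) :=
      ⟨fun h => ⟨h.2.1, by have := h.2.2; dsimp only at this; linarith⟩,
        fun h => ⟨hx.1, h.1, by have := h.2; dsimp only; linarith⟩⟩
    simp only [Set.indicator, this]
  · rw [Set.indicator_of_notMem hx]
    refine (lintegral_congr fun y => ?_).trans lintegral_zero
    refine Set.indicator_of_notMem (fun h => hx ⟨h.1, ?_⟩) _
    have h2 := h.2.1
    have h3 := h.2.2
    dsimp only at h2 h3
    linarith

theorem setLIntegral_openTriangle_pow {N b : ℕ} (hb : b ≤ N) :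
    ∫⁻ v in openTriangle, ENNReal.ofReal ((v.1 / (1 - v.1)) ^ b * (1 - v.1 - v.2) ^ N)
      = ENNReal.ofReal ((b.factorial * (N + 1 - b).factorial : ℝ)
          / ((N + 1) * (N + 2).factorial)) := by
  have hF : Measurable fun v : ℝ × ℝ =>
      ENNReal.ofReal ((v.1 / (1 - v.1)) ^ b * (1 - v.1 - v.2) ^ N) := by fun_prop
  rw [setLIntegral_openTriangle hF]
  -- The exponents cancel because `b ≤ N`, so the integrand becomes a polynomial.
  have hinner : ∀ x ∈ Set.Ioo (0 : ℝ) 1,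
      ∫⁻ y in Set.Ioo 0 (1 - x), ENNReal.ofReal ((x / (1 - x)) ^ b * (1 - x - y) ^ N)
        = ENNReal.ofReal (x ^ b * (1 - x) ^ (N + 1 - b) / (N + 1)) := by
    intro x hx
    have h1 : 0 < 1 - x := by linarith [hx.2]
    rw [setLIntegral_Ioo_ofReal (by fun_prop) h1.le]
    · congr 1
      rw [intervalIntegral.integral_const_mul,
        intervalIntegral.integral_comp_sub_left (fun y => y ^ N), integral_pow]
      simp only [sub_self, sub_zero, ne_eq, Nat.add_eq_zero_iff, one_ne_zero, and_false,
        not_false_eq_true, zero_pow]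
      rw [div_pow, ← mul_div_assoc, div_mul_eq_mul_div]
      congr 1
      rw [div_eq_iff (by positivity), mul_assoc, ← pow_add]
      congr 2
      omega
    · intro y hy
      have : 0 < 1 - x - y := by linarith [hy.2]
      have := hx.1
      positivity
  rw [setLIntegral_congr_fun measurableSet_Ioo hinner, setLIntegral_Ioo_ofReal (by fun_prop)
    zero_le_one]
  · rw [intervalIntegral.integral_div, integral_pow_mul_one_sub_pow,
      show N + 1 - b + b + 1 = N + 2 by omega]
    congr 1
    field_simp
  · intro x hx
    have h1 : 0 < 1 - x := by linarith [hx.2]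
    have := hx.1
    positivity

theorem volume_openTriangle : volume openTriangle = ENNReal.ofReal (1 / 2) := by
  have h := setLIntegral_openTriangle_pow (le_refl 0)
  simpa [Nat.factorial] using h

theorem openTriangle_subset_triangle : openTriangle ⊆ triangle := by
  rintro p ⟨h1, h2, h3⟩
  have hsum := (convex_convexHull ℝ {((0 : ℝ), (0 : ℝ)), (0, 1), (1, 0)}).sum_mem
    (t := Finset.univ) (w := ![1 - p.1 - p.2, p.2, p.1])
    (z := ![((0 : ℝ), (0 : ℝ)), (0, 1), (1, 0)])
    (by intro i _; fin_cases i <;> simp <;> linarith)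
    (by simp [Fin.sum_univ_three])
    (by intro i _; apply subset_convexHull; fin_cases i <;> simp)
  unfold triangle
  convert hsum using 1
  ext <;> simp [Fin.sum_univ_three]

theorem triangle_subset_closed : triangle ⊆ {p : ℝ × ℝ | 0 ≤ p.1 ∧ 0 ≤ p.2 ∧ p.1 + p.2 ≤ 1} := by
  refine convexHull_min ?_ convex_closedTriangle
  rintro p (rfl | rfl | rfl) <;> exact ⟨by norm_num, by norm_num, by norm_num⟩

/-- The sides of the triangle are preimages of a vertical line under invertible affine maps, hence
null sets. -/
theorem triangle_ae_eq_openTriangle : triangle =ᵐ[volume] openTriangle := by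
  refine (ae_eq_set.2 ⟨?_, ?_⟩)
  · set V : Set (ℝ × ℝ) := {0} ×ˢ Set.univ
    have hV : volume V = 0 := by
      rw [Measure.volume_eq_prod, Measure.prod_prod]
      simp
    have hline : ∀ {a b c d : ℝ} (_ : a * d - b * c ≠ 0) (e f : ℝ),
        volume (planeAffineMap a b c d e f ⁻¹' V) = 0 := fun h e f => by
      rw [volume_preimage_planeAffineMap h, hV, mul_zero]
    refine measure_mono_null (t := V ∪ (planeAffineMap 0 1 1 0 0 0 ⁻¹' V ∪
      planeAffineMap 1 1 0 1 (-1) 0 ⁻¹' V)) ?_ ?_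
    · rintro p ⟨hp, hp'⟩
      obtain ⟨h1, h2, h3⟩ := triangle_subset_closed hp
      by_contra hcon
      simp only [V, Set.mem_union, Set.mem_preimage, planeAffineMap_apply, Set.mem_prod,
        Set.mem_singleton_iff, Set.mem_univ, and_true, not_or] at hcon
      refine hp' ⟨lt_of_le_of_ne h1 (Ne.symm hcon.1), lt_of_le_of_ne h2 fun h => hcon.2.1 ?_,
        lt_of_le_of_ne h3 fun h => hcon.2.2 ?_⟩ <;> linarith
    · refine measure_union_null hV (measure_union_null (hline (by norm_num) _ _)
        (hline (by norm_num) _ _))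
  · rw [Set.sdiff_eq_empty.2 openTriangle_subset_triangle, measure_empty]

theorem cond_triangle :
    ProbabilityTheory.cond volume triangle = (2 : ENNReal) • volume.restrict openTriangle := by
  rw [ProbabilityTheory.cond, Measure.restrict_congr_set triangle_ae_eq_openTriangle,
    measure_congr triangle_ae_eq_openTriangle, volume_openTriangle]
  congr 1
  rw [← ENNReal.ofReal_inv_of_pos (by norm_num)]
  norm_num

/-! ### The recursion for configurations with a given number of vertices -/

theorem mem_openTriangle_of_farMap_mem {v p : ℝ × ℝ} (hv : v ∈ openTriangle)
    (hp : farMap v p ∈ openTriangle) : p ∈ openTriangle := by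
  obtain ⟨hx, hy, hxy⟩ := hv
  rw [farMap_apply] at hp
  obtain ⟨h1, h2, h3⟩ := hp
  dsimp only at h1 h2 h3
  have hs : 0 < 1 - v.1 - v.2 := by linarith
  have hγ : p.1 / v.1 * v.1 = p.1 := div_mul_cancel₀ _ hx.ne'
  have hβ : ((1 - v.1) * p.2 - v.2 * (1 - p.1)) / (1 - v.1 - v.2) * (1 - v.1 - v.2)
      = (1 - v.1) * p.2 - v.2 * (1 - p.1) := div_mul_cancel₀ _ hs.ne'
  set γ := p.1 / v.1
  set β := ((1 - v.1) * p.2 - v.2 * (1 - p.1)) / (1 - v.1 - v.2)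
  have hp1 : p.1 < 1 := by nlinarith
  have hp2 : 0 < (1 - v.1) * p.2 := by
    have := mul_pos h2 hs
    have := mul_pos hy (sub_pos.2 hp1)
    linarith
  have hβ1 : 0 < 1 - p.1 - β := by nlinarith
  have hp3 : 0 < (1 - v.1) * (1 - p.1 - p.2) := by
    have := mul_pos hs hβ1
    linarith
  refine ⟨?_, (mul_pos_iff_of_pos_left (by linarith)).1 hp2, ?_⟩
  · rw [← hγ]; positivity
  · have := (mul_pos_iff_of_pos_left (show 0 < 1 - v.1 by linarith)).1 hp3
    linarith

theorem mem_openTriangle_of_nearMap_mem {v p : ℝ × ℝ} (hv : v ∈ openTriangle)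
    (hp : nearMap v p ∈ openTriangle) : p ∈ openTriangle := by
  obtain ⟨hx, hy, hxy⟩ := hv
  rw [nearMap_apply] at hp
  obtain ⟨h1, h2, h3⟩ := hp
  dsimp only at h1 h2 h3
  have hs : 0 < 1 - v.1 - v.2 := by linarith
  have hk : (1 - p.1 - p.2) / (1 - v.1 - v.2) * (1 - v.1 - v.2) = 1 - p.1 - p.2 :=
    div_mul_cancel₀ _ hs.ne'
  set k := (1 - p.1 - p.2) / (1 - v.1 - v.2)
  have hk0 : 0 < k := by linarith
  have := mul_pos hk0 hx
  have := mul_pos hk0 hy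
  have := mul_pos hk0 hs
  exact ⟨by linarith, by linarith, by linarith⟩

/-- Of two points, at most one lies above the line joining the other one to `(1,0)`; so the point of
least angle is unique. -/
theorem sightValue_swap_neg {v p : ℝ × ℝ} (h : 0 < sightValue v p) : sightValue p v < 0 := by
  have : sightValue p v = - sightValue v p := by unfold sightValue; ring
  linarith

theorem measurable_farMap : Measurable fun q : (ℝ × ℝ) × (ℝ × ℝ) => farMap q.1 q.2 := by
  simp only [farMap_apply]
  fun_prop

theorem measurable_nearMap : Measurable fun q : (ℝ × ℝ) × (ℝ × ℝ) => nearMap q.1 q.2 := by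
  simp only [nearMap_apply]
  fun_prop

theorem volume_preimage_farMap {v : ℝ × ℝ} (hv : v ∈ openTriangle) (s : Set (ℝ × ℝ)) :
    volume (farMap v ⁻¹' s)
      = (Real.toNNReal (v.1 * (1 - v.1 - v.2) / (1 - v.1)) : ENNReal) * volume s := by
  have hdet := farMap_det_pos hv
  rw [farMap, volume_preimage_planeAffineMap hdet.ne']
  change ENNReal.ofReal _ * _ = ENNReal.ofReal _ * _
  congr 2
  rw [abs_of_pos (inv_pos.2 hdet), zero_mul, sub_zero, mul_inv, one_div, inv_inv, inv_div]
  ring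

theorem volume_preimage_nearMap {v : ℝ × ℝ} (hv : v ∈ openTriangle) (s : Set (ℝ × ℝ)) :
    volume (nearMap v ⁻¹' s) = ENNReal.ofReal (1 - v.1 - v.2) * volume s := by
  obtain ⟨hx, hy, hxy⟩ := hv
  have hs : 0 < 1 - v.1 - v.2 := by linarith
  have hdet : (1 + v.1 / (1 - v.1 - v.2)) * (1 + v.2 / (1 - v.1 - v.2))
      - v.1 / (1 - v.1 - v.2) * (v.2 / (1 - v.1 - v.2)) = (1 - v.1 - v.2)⁻¹ := by
    field_simp
    ring
  rw [nearMap, volume_preimage_planeAffineMap (by rw [hdet]; positivity), hdet, inv_inv,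
    abs_of_pos hs]

theorem measurePreserving_eval_prod_restrict {ι E : Type*} [Fintype ι] [DecidableEq ι]
    [MeasureSpace E] [SigmaFinite (volume : Measure E)] (i : ι) :
    MeasurePreserving (fun x : ι → E => (x i, fun j : {j // ¬ j = i} => x j)) volume
      (volume.prod volume) := by
  have h1 := measurePreserving_piEquivPiSubtypeProd (fun _ : ι => (volume : Measure E)) (· = i)
  have h2 : MeasurePreserving (MeasurableEquiv.funUnique {j // j = i} E)
      (@Measure.pi _ _ (Subtype.fintype _) _ fun _ => volume) volume := by
    convert measurePreserving_funUnique (volume : Measure E) {j // j = i}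
  exact (h2.prod (MeasurePreserving.id (volume : Measure ({j // ¬ j = i} → E)))).comp h1

theorem measurableSet_split {α κ κ' : Type*} [MeasurableSpace α] [Countable κ']
    {v : α → ℝ × ℝ} {a : α → κ → ℝ × ℝ} {b : α → κ' → ℝ × ℝ} (hv : Measurable v)
    (ha : ∀ j, Measurable fun q => a q j) (hb : ∀ j, Measurable fun q => b q j)
    {D : Set (κ → ℝ × ℝ)} (hD : MeasurableSet D) :
    MeasurableSet {q | v q ∈ openTriangle ∧ (fun j => farMap (v q) (a q j)) ∈ D ∧
      ∀ j, nearMap (v q) (b q j) ∈ openTriangle} := by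
  have hset : {q | v q ∈ openTriangle ∧ (fun j => farMap (v q) (a q j)) ∈ D ∧
      ∀ j, nearMap (v q) (b q j) ∈ openTriangle} = v ⁻¹' openTriangle ∩
        ((fun q j => farMap (v q) (a q j)) ⁻¹' D ∩
          ⋂ j, (fun q => nearMap (v q) (b q j)) ⁻¹' openTriangle) := by
    ext q
    simp
  rw [hset]
  refine (hv measurableSet_openTriangle).inter (MeasurableSet.inter ?_
    (MeasurableSet.iInter fun j => ?_))
  · exact (measurable_pi_lambda _ fun j => measurable_farMap.comp (hv.prodMk (ha j))) hD
  · exact (measurable_nearMap.comp (hv.prodMk (hb j))) measurableSet_openTriangle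

/-- The configurations in which `x i` lies in the open triangle, the other points with index in `p`,
transported by `farMap (x i)`, form a configuration in `D`, and all remaining points lie in the open
triangle with vertices `x i`, `(0,1)` and `(1,0)`. -/
def splitEvent {ι : Type*} (i : ι) (p : {j // ¬ j = i} → Prop)
    (D : Set ({j // p j} → ℝ × ℝ)) : Set (ι → ℝ × ℝ) :=
  {x | x i ∈ openTriangle ∧ (fun j : {j // p j} => farMap (x i) (x j.1)) ∈ D ∧
    ∀ j : {j // ¬ p j}, nearMap (x i) (x j.1) ∈ openTriangle}

section
variable {ι : Type*} {i : ι} {p : {j // ¬ j = i} → Prop}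
  {D : Set ({j // p j} → ℝ × ℝ)}

theorem measurableSet_splitEvent [Fintype ι] (hD : MeasurableSet D) :
    MeasurableSet (splitEvent i p D) :=
  measurableSet_split (measurable_pi_apply i) (fun _ => measurable_pi_apply _)
    (fun _ => measurable_pi_apply _) hD

/-- The configurations of the points other than `x i = v` that put `x` into `splitEvent i p D`. -/
def splitFiber (i : ι) (p : {j // ¬ j = i} → Prop) (D : Set ({j // p j} → ℝ × ℝ)) (v : ℝ × ℝ) :
    Set ({j // ¬ j = i} → ℝ × ℝ) :=
  {y | (fun j : {j // p j} => farMap v (y j.1)) ∈ D ∧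
    ∀ j : {j // ¬ p j}, nearMap v (y j.1) ∈ openTriangle}

theorem volume_splitFiber [Fintype ι] [DecidableEq ι] [DecidablePred p] (hD : MeasurableSet D)
    {v : ℝ × ℝ} (hv : v ∈ openTriangle) :
    volume (splitFiber i p D v) =
      (ENNReal.ofReal (v.1 * (1 - v.1 - v.2) / (1 - v.1)) ^ Fintype.card {j // p j} * volume D) *
        (ENNReal.ofReal (1 - v.1 - v.2) * ENNReal.ofReal (1 / 2)) ^ Fintype.card {j // ¬ p j} := by
  have hmp := volume_preserving_piEquivPiSubtypeProd (fun _ : {j // ¬ j = i} => ℝ × ℝ) p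
  have hmeas : Measurable (farMap v) := measurable_planeAffineMap _ _ _ _ _ _
  have hpre : splitFiber i p D v =
      (MeasurableEquiv.piEquivPiSubtypeProd (fun _ : {j // ¬ j = i} => ℝ × ℝ) p) ⁻¹'
        (((fun (y : {j // p j} → ℝ × ℝ) j => farMap v (y j)) ⁻¹' D) ×ˢ
          Set.univ.pi fun _ => nearMap v ⁻¹' openTriangle) := by
    ext y
    simp [splitFiber, MeasurableEquiv.piEquivPiSubtypeProd, Equiv.piEquivPiSubtypeProd]
  rw [hpre, hmp.measure_preimage_equiv, Measure.volume_eq_prod, Measure.prod_prod,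
    volume_pi_preimage_of_scaling hmeas (volume_preimage_farMap hv) hD, volume_pi_pi]
  simp only [volume_preimage_nearMap hv, volume_openTriangle, Finset.prod_const, Finset.card_univ]
  rfl

theorem volume_splitEvent [Fintype ι] [DecidableEq ι] [DecidablePred p] (hD : MeasurableSet D)
    {d : ℝ} (hd : 0 ≤ d) (hvol : volume D = ENNReal.ofReal d) {N b : ℕ} (hN : Fintype.card ι = N + 1)
    (hb : Fintype.card {j // p j} = b) :
    volume (splitEvent i p D) = ENNReal.ofReal (d * (1 / 2) ^ (N - b) *
      ((b.factorial * (N + 1 - b).factorial : ℝ) / ((N + 1) * (N + 2).factorial))) := by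
  have hcard : Fintype.card {j : ι // ¬ j = i} = N := by
    rw [Fintype.card_subtype_compl, Fintype.card_subtype_eq, hN]
    rfl
  have hbN : b ≤ N := by
    rw [← hb, ← hcard]
    exact Fintype.card_subtype_le p
  have hcompl : Fintype.card {j // ¬ p j} = N - b := by
    rw [Fintype.card_subtype_compl, hcard, hb]
  set G : Set ((ℝ × ℝ) × ({j // ¬ j = i} → ℝ × ℝ)) :=
    {q | q.1 ∈ openTriangle ∧ q.2 ∈ splitFiber i p D q.1} with hG
  have hGm : MeasurableSet G :=
    measurableSet_split measurable_fst (fun _ => (measurable_pi_apply _).comp measurable_snd)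
      (fun _ => (measurable_pi_apply _).comp measurable_snd) hD
  have hmp := measurePreserving_eval_prod_restrict (E := ℝ × ℝ) i
  have hpre : splitEvent i p D =
      (fun x : ι → ℝ × ℝ => (x i, fun j : {j // ¬ j = i} => x j)) ⁻¹' G := rfl
  rw [hpre, hmp.measure_preimage hGm.nullMeasurableSet, Measure.prod_apply hGm]
  have hfib : ∀ v, volume (Prod.mk v ⁻¹' G) = openTriangle.indicator (fun v =>
      ENNReal.ofReal (d * (1 / 2) ^ (N - b)) *
        ENNReal.ofReal ((v.1 / (1 - v.1)) ^ b * (1 - v.1 - v.2) ^ N)) v := by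
    intro v
    by_cases hv : v ∈ openTriangle
    · have : Prod.mk v ⁻¹' G = splitFiber i p D v := by
        ext y
        simp [hG, hv]
      rw [Set.indicator_of_mem hv, this, volume_splitFiber hD hv, hvol, hb, hcompl]
      obtain ⟨hx, hy, hxy⟩ := hv
      have hs : 0 < 1 - v.1 - v.2 := by linarith
      have h1 : 0 < 1 - v.1 := by linarith
      rw [← ENNReal.ofReal_mul (by positivity), ← ENNReal.ofReal_mul (by positivity),
        ← ENNReal.ofReal_pow (by positivity), ← ENNReal.ofReal_pow (by positivity),
        ← ENNReal.ofReal_mul (by positivity), ← ENNReal.ofReal_mul (by positivity)]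
      congr 1
      obtain ⟨a, rfl⟩ := Nat.exists_eq_add_of_le hbN
      rw [Nat.add_sub_cancel_left, pow_add (1 - v.1 - v.2), mul_pow, div_pow, div_pow, mul_pow]
      ring
    · rw [Set.indicator_of_notMem hv]
      have : Prod.mk v ⁻¹' G = ∅ := by
        ext y
        simp [hG, hv]
      rw [this, measure_empty]
  simp only [hfib]
  rw [lintegral_indicator measurableSet_openTriangle, lintegral_const_mul _ (by fun_prop),
    setLIntegral_openTriangle_pow hbN, ← ENNReal.ofReal_mul (by positivity)]

theorem mem_openTriangle_of_mem_splitEvent (hDT : ∀ y ∈ D, ∀ j, y j ∈ openTriangle)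
    {x : ι → ℝ × ℝ} (hx : x ∈ splitEvent i p D) (j : ι) : x j ∈ openTriangle := by
  obtain ⟨hv, hfar, hnear⟩ := hx
  by_cases hj : j = i
  · exact hj ▸ hv
  by_cases hp : p ⟨j, hj⟩
  · exact mem_openTriangle_of_farMap_mem hv (hDT _ hfar ⟨⟨j, hj⟩, hp⟩)
  · exact mem_openTriangle_of_nearMap_mem hv (hnear ⟨⟨j, hj⟩, hp⟩)

theorem sightValue_pos_of_mem_splitEvent (hDT : ∀ y ∈ D, ∀ j, y j ∈ openTriangle)
    {x : ι → ℝ × ℝ} (hx : x ∈ splitEvent i p D) {j : ι} (hj : ¬ j = i) :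
    0 < sightValue (x i) (x j) := by
  obtain ⟨hv, hfar, hnear⟩ := hx
  by_cases hp : p ⟨j, hj⟩
  · exact sightValue_pos_of_farMap_mem hv (hDT _ hfar ⟨⟨j, hj⟩, hp⟩)
  · exact sightValue_pos_of_nearMap_mem hv (hnear ⟨⟨j, hj⟩, hp⟩)

theorem farMap_mem_iff_of_mem_splitEvent (hDT : ∀ y ∈ D, ∀ j, y j ∈ openTriangle)
    {x : ι → ℝ × ℝ} (hx : x ∈ splitEvent i p D) (j : {j // ¬ j = i}) :
    farMap (x i) (x j) ∈ openTriangle ↔ p j := by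
  obtain ⟨hv, hfar, hnear⟩ := hx
  refine ⟨fun h => ?_, fun hp => hDT _ hfar ⟨j, hp⟩⟩
  by_contra hp
  exact farMap_notMem_of_nearMap_mem hv (hnear ⟨j, hp⟩) h

theorem ncard_freeVertices_of_mem_splitEvent [Finite ι] (hDT : ∀ y ∈ D, ∀ j, y j ∈ openTriangle)
    {k : ℕ} (hDk : ∀ y ∈ D, (freeVertices (Set.range y) (0, 1) (1, 0)).ncard = k)
    {x : ι → ℝ × ℝ} (hx : x ∈ splitEvent i p D) :
    (freeVertices (Set.range x) (0, 1) (1, 0)).ncard = k + 1 := by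
  obtain ⟨hv, hfar, hnear⟩ := hx
  have hrange : Set.range x = insert (x i)
      (Set.range (fun j : {j // p j} => x j.1) ∪ Set.range fun j : {j // ¬ p j} => x j.1) := by
    ext w
    constructor
    · rintro ⟨j, rfl⟩
      by_cases hj : j = i
      · exact Or.inl (by rw [hj])
      by_cases hp : p ⟨j, hj⟩
      · exact Or.inr (Or.inl ⟨⟨⟨j, hj⟩, hp⟩, rfl⟩)
      · exact Or.inr (Or.inr ⟨⟨⟨j, hj⟩, hp⟩, rfl⟩)
    · rintro (rfl | ⟨j, rfl⟩ | ⟨j, rfl⟩) <;> exact ⟨_, rfl⟩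
  rw [hrange, ncard_freeVertices_insert_union hv (Set.toFinite _), ← Set.range_comp]
  · rw [← hDk _ hfar]
    rfl
  · rintro _ ⟨j, rfl⟩
    exact hDT _ hfar j
  · rintro _ ⟨j, rfl⟩
    exact hnear j
end

/-- There are `k`-vertex events with the expected volume in the space of configurations of `n` points
in the triangle. They are not claimed to contain every `k`-vertex configuration. The volume of
the triangle is `1 / 2`, whence the factor `(1 / 2) ^ n`. -/
theorem exists_event_card_freeVertices (n : ℕ) : ∀ (ι : Type) [Fintype ι], Fintype.card ι = n →
    ∀ k, ∃ D : Set (ι → ℝ × ℝ), MeasurableSet D ∧ (∀ x ∈ D, ∀ j, x j ∈ openTriangle) ∧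
      (∀ x ∈ D, (freeVertices (Set.range x) (0, 1) (1, 0)).ncard = k) ∧
      volume D = ENNReal.ofReal (explicitProb n k * (1 / 2) ^ n) := by
  classical
  induction n using Nat.strong_induction_on with
  | _ n ih =>
  intro ι _ hcard k
  cases k with
  | zero =>
    rcases Nat.eq_zero_or_pos n with rfl | hn
    · have : IsEmpty ι := Fintype.card_eq_zero_iff.1 hcard
      refine ⟨Set.univ, MeasurableSet.univ, fun x _ j => isEmptyElim j, fun x _ => ?_, ?_⟩
      · simp [freeVertices]
      · rw [← Set.pi_univ Set.univ, volume_pi_pi]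
        simp [explicitProb_zero_right]
    · exact ⟨∅, MeasurableSet.empty, by simp, by simp,
        by simp [explicitProb_zero_right, hn.ne']⟩
  | succ k =>
    cases n with
    | zero => exact ⟨∅, MeasurableSet.empty, by simp, by simp, by simp [explicitProb_succ]⟩
    | succ N =>
    have hcardi : ∀ i : ι, Fintype.card {j : ι // ¬ j = i} = N := by
      intro i
      rw [Fintype.card_subtype_compl, Fintype.card_subtype_eq, hcard]
      rfl
    have hcardS : ∀ (i : ι) (S : Finset {j // ¬ j = i}),
        @Fintype.card {j // j ∈ S} (Subtype.fintype fun j => j ∈ S) = S.card := by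
      intro i S
      convert Fintype.card_coe S
    have hlt : ∀ (i : ι) (S : Finset {j // ¬ j = i}), S.card < N + 1 := by
      intro i S
      rw [Nat.lt_succ_iff, ← hcardi i]
      exact Finset.card_le_univ S
    -- `i` is the index of the point of least angle, and `S` indexes the points beyond it.
    choose D hDm hDT hDk hDvol using fun (i : ι) (S : Finset {j // ¬ j = i}) =>
      @ih S.card (hlt i S) {j // j ∈ S} (Subtype.fintype fun j => j ∈ S) (hcardS i S) k
    have hvol : ∀ i (S : Finset {j // ¬ j = i}),
        volume (splitEvent i (fun j => j ∈ S) (D i S)) = ENNReal.ofReal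
          (explicitProb S.card k * (1 / 2) ^ S.card * (1 / 2) ^ (N - S.card) *
          ((S.card.factorial * (N + 1 - S.card).factorial : ℝ) /
            ((N + 1) * (N + 2).factorial))) := by
      intro i S
      refine volume_splitEvent (hDm i S)
        (mul_nonneg (explicitProb_nonneg _ _) (by positivity)) (hDvol i S) hcard (hcardS i S)
    refine ⟨⋃ q : (i : ι) × Finset {j // ¬ j = i},
      splitEvent q.1 (fun j => j ∈ q.2) (D q.1 q.2),
      MeasurableSet.iUnion fun q => measurableSet_splitEvent (hDm _ _), ?_, ?_, ?_⟩
    · intro x hx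
      obtain ⟨q, hq⟩ := Set.mem_iUnion.1 hx
      exact mem_openTriangle_of_mem_splitEvent (hDT _ _) hq
    · intro x hx
      obtain ⟨q, hq⟩ := Set.mem_iUnion.1 hx
      exact ncard_freeVertices_of_mem_splitEvent (hDT _ _) (hDk _ _) hq
    · have hdisj : Pairwise (Function.onFun Disjoint fun q : (i : ι) × Finset {j // ¬ j = i} =>
          splitEvent q.1 (fun j => j ∈ q.2) (D q.1 q.2)) := by
        rintro ⟨i, S⟩ ⟨i', S'⟩ hne
        refine Set.disjoint_left.2 fun x hx hx' => hne ?_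
        obtain rfl : i = i' := by
          by_contra hi
          have h1 := sightValue_pos_of_mem_splitEvent (hDT _ _) hx (Ne.symm hi)
          have h2 := sightValue_pos_of_mem_splitEvent (hDT _ _) hx' hi
          exact (sightValue_swap_neg h1).not_gt h2
        congr 1
        ext j
        rw [← farMap_mem_iff_of_mem_splitEvent (hDT _ _) hx j,
          ← farMap_mem_iff_of_mem_splitEvent (hDT _ _) hx' j]
      rw [measure_iUnion hdisj fun q => measurableSet_splitEvent (hDm _ _), tsum_fintype,
        Fintype.sum_sigma]
      simp only [hvol]
      have hnonneg : ∀ m : ℕ, 0 ≤ explicitProb m k * (1 / 2) ^ m * (1 / 2) ^ (N - m) *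
          ((m.factorial * (N + 1 - m).factorial : ℝ) / ((N + 1) * (N + 2).factorial)) := fun m =>
        mul_nonneg (mul_nonneg (mul_nonneg (explicitProb_nonneg _ _) (by positivity))
          (by positivity)) (by positivity)
      have hinner : ∀ i : ι, ∑ S : Finset {j // ¬ j = i}, ENNReal.ofReal
          (explicitProb S.card k * (1 / 2) ^ S.card * (1 / 2) ^ (N - S.card) *
          ((S.card.factorial * (N + 1 - S.card).factorial : ℝ) /
            ((N + 1) * (N + 2).factorial)))
          = ENNReal.ofReal (explicitProb (N + 1) (k + 1) * (1 / 2) ^ (N + 1) / (N + 1)) := by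
        intro i
        rw [← ENNReal.ofReal_sum_of_nonneg fun S _ => hnonneg _, ← Finset.powerset_univ,
          Finset.sum_powerset_apply_card fun m => explicitProb m k * (1 / 2) ^ m *
            (1 / 2) ^ (N - m) *
            ((m.factorial * (N + 1 - m).factorial : ℝ) / ((N + 1) * (N + 2).factorial)),
          Finset.card_univ, hcardi i, explicitProb_succ, Finset.sum_mul, Finset.sum_div]
        congr 1
        refine Finset.sum_congr rfl fun m hm => ?_
        obtain ⟨a, rfl⟩ := Nat.exists_eq_add_of_le (Nat.lt_succ_iff.1 (Finset.mem_range.1 hm))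
        have hch : ((m + a).choose m : ℝ) * m.factorial * a.factorial = (m + a).factorial := by
          have := Nat.choose_mul_factorial_mul_factorial (Nat.le_add_right m a)
          rw [Nat.add_sub_cancel_left] at this
          exact_mod_cast this
        have hfac : ((m + a).factorial : ℝ) ≠ 0 := by positivity
        rw [Nat.add_sub_cancel_left, show m + a + 1 - m = a + 1 by omega, nsmul_eq_mul,
          Nat.factorial_succ a, Nat.factorial_succ (m + a + 1), Nat.factorial_succ (m + a)]
        push_cast
        calc _ = ((m + a).choose m : ℝ) * m.factorial * a.factorial *
              (explicitProb m k * (1 / 2) ^ (m + a) * (a + 1) /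
                ((m + a + 1) * ((m + a + 1 + 1) * ((m + a + 1) * (m + a).factorial)))) := by ring
          _ = _ := by
            rw [hch]
            field_simp
            ring
      simp only [hinner]
      rw [Finset.sum_const, Finset.card_univ, hcard, nsmul_eq_mul, ← ENNReal.ofReal_natCast,
        ← ENNReal.ofReal_mul (by positivity)]
      congr 1
      push_cast
      field_simp

/-! ### The law of the number of vertices -/

theorem volume_restrict_openTriangle_pi {n : ℕ} {D : Set (Fin n → ℝ × ℝ)} (hD : MeasurableSet D)
    (hDT : ∀ x ∈ D, ∀ j, x j ∈ openTriangle) :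
    Measure.pi (fun _ : Fin n => (2 : ENNReal) • (volume.restrict openTriangle)) D
      = 2 ^ n * volume D := by
  have hpi : Measure.pi (fun _ : Fin n => (2 : ENNReal) • (volume.restrict openTriangle))
      = (2 : ENNReal) ^ n • (volume : Measure (Fin n → ℝ × ℝ)).restrict
        (Set.univ.pi fun _ => openTriangle) := by
    have hsf : SigmaFinite ((2 : ENNReal) • (volume : Measure (ℝ × ℝ)).restrict openTriangle) := by
      rw [← cond_triangle]
      infer_instance
    refine Measure.pi_eq fun s hs => ?_
    rw [volume_pi, Measure.restrict_pi_pi, Measure.smul_apply, Measure.pi_pi]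
    simp [Finset.prod_mul_distrib]
  have hsub : D ⊆ Set.univ.pi fun _ => openTriangle := fun x hx => Set.mem_univ_pi.2 (hDT x hx)
  rw [hpi, Measure.smul_apply, smul_eq_mul, Measure.restrict_apply hD, Set.inter_eq_left.2 hsub]

/-- The event `A k` lies in `{vertexCount = k}` and has probability `explicitProb n k`. These
numbers sum to `1`, and the sets `{vertexCount = k}` are disjoint, so equality holds; measurability of
`{vertexCount = k}` is not needed. -/
theorem vertexProb_eq_explicitProb {Ω : Type*} [MeasurableSpace Ω] (P : Measure Ω)
    [IsProbabilityMeasure P] {n : ℕ} (X : Fin n → Ω → ℝ × ℝ) (hmeas : ∀ i, Measurable (X i))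
    (hindep : iIndepFun X P) (hunif : ∀ i, pdf.IsUniform (X i) triangle P volume) {k : ℕ}
    (hk : k ≤ n) : vertexProb P X k = explicitProb n k := by
  choose D hDm hDT hDk hDvol using exists_event_card_freeVertices n (Fin n) (Fintype.card_fin n)
  have hXm : Measurable fun ω i => X i ω := measurable_pi_lambda _ hmeas
  have hlaw : P.map (fun ω i => X i ω)
      = Measure.pi fun _ : Fin n => (2 : ENNReal) • (volume.restrict openTriangle) := by
    rw [hindep.map_fun_eq_pi_map fun i => (hmeas i).aemeasurable]
    congr 1
    ext1 i
    rw [← cond_triangle]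
    exact hunif i
  set A : ℕ → Set Ω := fun k => (fun ω i => X i ω) ⁻¹' D k with hA
  have hAm : ∀ k, MeasurableSet (A k) := fun k => hXm (hDm k)
  have hAP : ∀ k, P.real (A k) = explicitProb n k := by
    intro k
    rw [measureReal_def, hA, ← Measure.map_apply hXm (hDm k), hlaw,
      volume_restrict_openTriangle_pi (hDm k) (hDT k), hDvol, ENNReal.toReal_mul,
      ENNReal.toReal_ofReal (mul_nonneg (explicitProb_nonneg n k) (by positivity)),
      ENNReal.toReal_pow, ENNReal.toReal_ofNat, mul_left_comm, ← mul_pow]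
    norm_num
  have hAcount : ∀ k, ∀ ω ∈ A k, vertexCount (fun i => X i ω) = k := fun k ω hω =>
    (vertexCount_eq_ncard_freeVertices (hDT k _ hω)).trans (hDk k _ hω)
  have hdisj : Pairwise (Function.onFun Disjoint A) := fun k l hkl =>
    Set.disjoint_left.2 fun ω hk hl => hkl ((hAcount k ω hk).symm.trans (hAcount l ω hl))
  refine le_antisymm ?_ ?_
  · set B := ⋃ l ∈ (Finset.range (n + 1)).erase k, A l with hB
    have hBm : MeasurableSet B := Finset.measurableSet_biUnion _ fun l _ => hAm l
    have hBP : P.real B = 1 - explicitProb n k := by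
      rw [hB, measureReal_biUnion_finset (fun _ _ _ _ h => hdisj h) fun l _ => hAm l,
        ← sum_explicitProb n, ← Finset.sum_erase_add _ _ (Finset.mem_range.2 (Nat.lt_succ_of_le hk))]
      simp [hAP]
    have hsub : {ω | vertexCount (fun i => X i ω) = k} ⊆ Bᶜ := by
      intro ω hω hωB
      obtain ⟨l, hl, hωl⟩ := Set.mem_iUnion₂.1 hωB
      exact (Finset.mem_erase.1 hl).1 ((hAcount l ω hωl).symm.trans hω)
    calc P.real {ω | vertexCount (fun i => X i ω) = k} ≤ P.real Bᶜ := measureReal_mono hsub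
      _ = explicitProb n k := by rw [probReal_compl_eq_one_sub hBm, hBP]; ring
  · rw [← hAP k]
    exact measureReal_mono fun ω hω => hAcount k ω hω

end RandomConvexChain

end

theorem theorem2p7 {Ω : Type*} [MeasurableSpace Ω] (P : Measure Ω) [IsProbabilityMeasure P]
    (n : ℕ) (hn : 1 ≤ n) (X : Fin n → Ω → ℝ × ℝ) (hmeas : ∀ i, Measurable (X i))
    (hindep : iIndepFun X P)
    (hunif : ∀ i, pdf.IsUniform (X i) RandomConvexChain.triangle P volume) :
    (∀ k, 1 ≤ k → k ≤ n →
      RandomConvexChain.vertexProb P X k = RandomConvexChain.explicitProb n k) ∧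
    RandomConvexChain.IsPolyaFrequency
      (RandomConvexChain.extendByZero n (RandomConvexChain.vertexProb P X)) := by
  have hprob : ∀ k, k ≤ n →
      RandomConvexChain.vertexProb P X k = RandomConvexChain.explicitProb n k := fun k hk =>
    RandomConvexChain.vertexProb_eq_explicitProb P X hmeas hindep hunif hk
  refine ⟨fun k _ hk => hprob k hk, ?_⟩
  have hext : RandomConvexChain.extendByZero n (RandomConvexChain.vertexProb P X)
      = RandomConvexChain.explicitProb n := by
    funext k
    unfold RandomConvexChain.extendByZero
    split_ifs with hk
    · exact hprob k hk.2
    · rcases Nat.eq_zero_or_pos k with rfl | hpos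
      · rw [RandomConvexChain.explicitProb_zero_right, if_neg (by omega)]
      · exact (RandomConvexChain.explicitProb_eq_zero (by omega)).symm
  rw [hext]
  exact RandomConvexChain.isPolyaFrequency_explicitProb n
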